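/- Let $n\ge 1$, let $f:\mathbb{R}^n\to\mathbb{R}$ be twice continuously differentiable (possibly non-convex) with $\|\nabla^2 f(y)-\nabla^2 f(x)\|\le L\|y-x\|$ for all $x,y$ (Euclidean and spectral norms, $L\ge 0$), let $\psi:\mathbb{R}^n\to\mathbb{R}\cup\{+\infty\}$ be proper, closed and convex, $Q=\operatorname{dom}\psi$, $F=f+\psi$, and assume $F^\star=\inf_Q F>-\infty$. Fix $x_0\in Q$, $\tau_0>0$, $\epsilon>0$ and $m\in\mathbb{N}$, $m\ge 1$. Write $$M_{x,\sigma}(y)=f(x)+\langle\nabla f(x),y-x\rangle+\tfrac12\langle B(y-x),y-x\rangle+\tfrac{\sigma}{6}\|y-x\|^3 .$$ *Procedure* $\mathtt{CubicSteps}(x,B,\sigma,m,\epsilon)$. Put $z_0=x$, $t=0$. (1) If $t=m$, return $(z_t,\mathtt{success})$. (2) Choose any $z_{t+1}\in Q$ and $\psi'(z_{t+1})\in\partial\psi(z_{t+1})$ with $$M_{z_t,\sigma}(z_{t+1})+\psi(z_{t+1})\le F(z_t),\qquad \|\nabla M_{z_t,\sigma}(z_{t+1})+\psi'(z_{t+1})\|\le\tfrac{\sigma}{4}\|z_{t+1}-z_t\|^2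 .$$ (3) If $\|\nabla f(z_{t+1})+\psi'(z_{t+1})\|\le\epsilon$, return $(z_{t+1},\mathtt{solution})$. (4) If $F(z_0)-F(z_{t+1})\ge\frac{\epsilon^{3/2}}{384\,\sigma^{1/2}}(t+1)$, increase $t$ by one and go to (1); otherwise return $(z_{t+1},\mathtt{halt})$. *Algorithm 2 (first-order cubic Newton method).* For $k=0,1,\dots$: for $\ell=0,1,\dots$ put $$\sigma_{k,\ell}=2^4\left(\tfrac23\right)^{1/3}(2^\ell\tau_k)\,m,\qquad h_{k,\ell}=\left[\frac{3\,\sigma_{k,\ell}^{3/2}\epsilon^{3/2}}{2^7\cdot192\, n^{3/2}(2^\ell\tau_k)^3}\right]^{1/3},$$ $B_{k,\ell}=\frac12(A_{k,\ell}+A_{k,\ell}^\top)$, where the $j$-th column of $A_{k,\ell}$ is $\big(\nabla f(x_k+h_{k,\ell}e_j)-\nabla f(x_k)\big)/h_{k,\ell}$, and call $\mathtt{CubicSteps}(x_k,B_{k,\ell},\sigma_{k,\ell},m,\epsilon)$, until for some $\ell=\ell_k$ the returned status is not $\mathtt{halt}$. Let $x_{k+1}$ be the returned point. If the status is $\mathtt{success}$,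 set $\tau_{k+1}=\max\{\tau_0,2^{\ell_k-1}\tau_k\}$ and continue with $k+1$; if it is $\mathtt{solution}$, stop. **Claim.** Take $m:=n$. Then Algorithm 2 needs at most $$\mathcal{O}\left(n^{1/2}\epsilon^{-3/2}+n\right)$$ evaluations of $f$ and $\nabla f$ in total to generate an iterate $x_k$ with $\|\nabla f(x_k)+\psi'(x_k)\|\le\epsilon$ for some $\psi'(x_k)\in\partial\psi(x_k)$. More precisely: for all $L\ge0$, $\tau_0>0$ and $\Delta\in\mathbb{R}$ there is a constant $C$, depending only on $L,\tau_0,\Delta$, such that for all $n\geq 1$, $\epsilon>0$ and all $f,\psi,x_0$ as above with $F(x_0)-F^\star\le\Delta$, the method with $m=n$ never gets stuck (an admissible $z_{t+1}$ always exists), every execution of it, whatever admissible points are chosen, stops after finitely many steps at such an iterate $x_k$, and it makes at most $C\,(n^{1/2}\epsilon^{-3/2}+n)$ evaluations of $f$ and $\nabla f$ on the way (every evaluation is counted, also repeated ones). -/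

import Mathlib

namespace FirstOrderCNM

/-- Euclidean space `ℝⁿ`. -/
abbrev E (n : ℕ) : Type := EuclideanSpace ℝ (Fin n)

/-! ### The composite problem `min { F x = f x + ψ x : x ∈ Q = dom ψ }` -/

/-- `Q = dom ψ`, for an extended-real-valued `ψ`. -/
def dom {n : ℕ} (ψ : E n → EReal) : Set (E n) := {x | ψ x ≠ ⊤}

/-- The epigraph of `ψ`, a subset of `ℝⁿ × ℝ`. -/
def epigraph {n : ℕ} (ψ : E n → EReal) : Set (E n × ℝ) := {p | ψ p.1 ≤ (p.2 : EReal)}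

/-- `ψ : ℝⁿ → ℝ ∪ {+∞}` is proper, closed and convex. -/
structure IsProperClosedConvex {n : ℕ} (ψ : E n → EReal) : Prop where
  ne_bot : ∀ x, ψ x ≠ ⊥
  dom_nonempty : (dom ψ).Nonempty
  closed : IsClosed (epigraph ψ)
  convex : Convex ℝ (epigraph ψ)

/-- The subdifferential `∂ψ(x)` of a convex function. -/
def subdifferential {n : ℕ} (ψ : E n → EReal) (x : E n) : Set (E n) :=
  {v | x ∈ dom ψ ∧ ∀ y, ψ x + ((inner ℝ v (y - x) : ℝ) : EReal) ≤ ψ y}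

/-- The objective `F = f + ψ`. -/
noncomputable def F {n : ℕ} (f : E n → ℝ) (ψ : E n → EReal) (x : E n) : EReal :=
  (f x : EReal) + ψ x

/-- `F⋆ = inf { F x : x ∈ Q }`. -/
noncomputable def Fstar {n : ℕ} (f : E n → ℝ) (ψ : E n → EReal) : EReal :=
  ⨅ x ∈ dom ψ, F f ψ x

/-- The Hessian of `f` at `x`, as the linear operator that is the Jacobian of `∇f`.
Its operator norm is the spectral norm of the Hessian matrix. -/
noncomputable def hessian {n : ℕ} (f : E n → ℝ) (x : E n) : E n →L[ℝ] E n :=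
  fderiv ℝ (gradient f) x

/-- The Hessian of `f` is Lipschitz continuous with constant `L`. -/
def HasLipschitzHessian {n : ℕ} (f : E n → ℝ) (L : ℝ) : Prop :=
  ∀ x y : E n, ‖hessian f y - hessian f x‖ ≤ L * ‖y - x‖

/-- `‖∇f(x) + ψ'(x)‖ ≤ ε` for some `ψ'(x) ∈ ∂ψ(x)`. -/
def IsApproxStationary {n : ℕ} (f : E n → ℝ) (ψ : E n → EReal) (ε : ℝ) (x : E n) : Prop :=
  ∃ v ∈ subdifferential ψ x, ‖gradient f x + v‖ ≤ ε

/-! ### The cubic model and inexact cubic steps -/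

/-- The model
`M_{x,σ}(y) = f(x) + ⟨∇f(x), y - x⟩ + ½⟨B(y - x), y - x⟩ + (σ/6)‖y - x‖³`. -/
noncomputable def model {n : ℕ} (f : E n → ℝ) (B : Matrix (Fin n) (Fin n) ℝ) (σ : ℝ)
    (x y : E n) : ℝ :=
  f x + inner ℝ (gradient f x) (y - x)
    + 1 / 2 * inner ℝ (Matrix.toEuclideanLin B (y - x)) (y - x)
    + σ / 6 * ‖y - x‖ ^ 3

/-- `y`, together with the subgradient `v ∈ ∂ψ(y)`, is an admissible approximate solution of
`min { M_{x,σ}(y) + ψ(y) : y ∈ Q }`. -/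
structure IsCubicStep {n : ℕ} (f : E n → ℝ) (ψ : E n → EReal) (B : Matrix (Fin n) (Fin n) ℝ)
    (σ : ℝ) (x y v : E n) : Prop where
  subgradient : v ∈ subdifferential ψ y
  model_le : ((model f B σ x y : ℝ) : EReal) + ψ y ≤ F f ψ x
  gradient_le : ‖gradient (model f B σ x) y + v‖ ≤ σ / 4 * ‖y - x‖ ^ 2

/-! ### Parameters of the method -/

/-- `σ_{k,ℓ} = 2⁴ (2/3)^{1/3} (2^ℓ τ_k) m`. -/
noncomputable def sigma (m : ℕ) (τ : ℝ) (l : ℕ) : ℝ :=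
  2 ^ 4 * (2 / 3 : ℝ) ^ (1 / 3 : ℝ) * (2 ^ l * τ) * m

/-- `h_{k,ℓ} = [3 σ_{k,ℓ}^{3/2} ε^{3/2} / (2⁷ · 192 · n^{3/2} (2^ℓ τ_k)³)]^{1/3}`. -/
noncomputable def stepsize (n m : ℕ) (ε τ : ℝ) (l : ℕ) : ℝ :=
  (3 * sigma m τ l ^ (3 / 2 : ℝ) * ε ^ (3 / 2 : ℝ)
    / (2 ^ 7 * 192 * (n : ℝ) ^ (3 / 2 : ℝ) * (2 ^ l * τ) ^ 3)) ^ (1 / 3 : ℝ)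

/-- The standard basis vector `e_j`. -/
noncomputable def e {n : ℕ} (j : Fin n) : E n := EuclideanSpace.single j (1 : ℝ)

/-- The matrix whose `j`-th column is `(∇f(x + h e_j) - ∇f(x)) / h`. -/
noncomputable def diffMatrix {n : ℕ} (f : E n → ℝ) (x : E n) (h : ℝ) :
    Matrix (Fin n) (Fin n) ℝ :=
  Matrix.of fun i j => (gradient f (x + h • e j) i - gradient f x i) / h

/-- The finite-difference Hessian approximation `B = ½ (A + Aᵀ)`. -/
noncomputable def hessApprox {n : ℕ} (f : E n → ℝ) (x : E n) (h : ℝ) :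
    Matrix (Fin n) (Fin n) ℝ :=
  (1 / 2 : ℝ) • (diffMatrix f x h + (diffMatrix f x h).transpose)

/-! ### The method as a transition system with a log of oracle calls -/

/-- A call of the first-order oracle: evaluation of `f`, or of `∇f`, at a point. -/
inductive Query (n : ℕ) : Type
  | value (x : E n) : Query n
  | grad (x : E n) : Query n

/-- Control states of the method. -/
inductive State (n : ℕ) : Type
  /-- At Step 1.1 of the main loop, in iteration `k` at the point `x = x_k`, with `τ = τ_k` and
  with adaptive search index `l`. -/
  | outer (k : ℕ) (x : E n) (τ : ℝ) (l : ℕ) : State n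
  /-- At Step 1 of `CubicSteps(x, B, σ_{k,l}, m, ε)`, called by the main loop in the state
  `outer k x τ l`, with inner counter `t` and current inner point `z`
  (so the inner point with index `0` is `x`). -/
  | inner (k : ℕ) (x : E n) (τ : ℝ) (l : ℕ) (B : Matrix (Fin n) (Fin n) ℝ)
      (t : ℕ) (z : E n) : State n
  /-- The method has stopped; its last iterate is `x = x_k`. -/
  | stopped (k : ℕ) (x : E n) : State n

/-- The gradient evaluations that form `hessApprox f x h`. -/
noncomputable def hessQueries {n : ℕ} (x : E n) (h : ℝ) : List (Query n) :=
  Query.grad x :: List.ofFn fun j : Fin n => Query.grad (x + h • e j)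

/-- `Step f ψ τ₀ ε m s q s'`: from state `s` the first-order cubic Newton method can pass to
state `s'` with the oracle calls `q`. The choice of the approximate solution of the subproblem is
left open. Nothing is cached: a value that is used again is paid for again. -/
inductive Step {n : ℕ} (f : E n → ℝ) (ψ : E n → EReal) (τ₀ ε : ℝ) (m : ℕ) :
    State n → List (Query n) → State n → Prop
  /-- Form `B_{k,l}` and call `CubicSteps` at `x_k`. -/
  | call (k : ℕ) (x : E n) (τ : ℝ) (l : ℕ) :
      Step f ψ τ₀ ε m (.outer k x τ l)
        (hessQueries x (stepsize n m ε τ l))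
        (.inner k x τ l (hessApprox f x (stepsize n m ε τ l)) 0 x)
  /-- All `m` inner steps are done: `CubicSteps` returns `success`, and the main loop sets
  `x_{k+1} = z` and `τ_{k+1} = max {τ₀, 2^{l-1} τ_k}`. -/
  | success (k : ℕ) (x : E n) (τ : ℝ) (l : ℕ) (B : Matrix (Fin n) (Fin n) ℝ) (z : E n) :
      Step f ψ τ₀ ε m (.inner k x τ l B m z) []
        (.outer (k + 1) z (max τ₀ ((2 : ℝ) ^ ((l : ℤ) - 1) * τ)) 0)
  /-- The new inner point `y` passes the gradient test: `CubicSteps` returns `solution`, and the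
  main loop sets `x_{k+1} = y` and stops. -/
  | solution (k : ℕ) (x : E n) (τ : ℝ) (l : ℕ) (B : Matrix (Fin n) (Fin n) ℝ) (t : ℕ)
      (z y v : E n) (ht : t ≠ m) (hy : IsCubicStep f ψ B (sigma m τ l) z y v)
      (hgrad : ‖gradient f y + v‖ ≤ ε) :
      Step f ψ τ₀ ε m (.inner k x τ l B t z) [.value z, .grad z, .grad y] (.stopped (k + 1) y)
  /-- The new inner point `y` fails the gradient test and passes the progress test: go on with
  inner counter `t + 1`. -/
  | advance (k : ℕ) (x : E n) (τ : ℝ) (l : ℕ) (B : Matrix (Fin n) (Fin n) ℝ) (t : ℕ)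
      (z y v : E n) (ht : t ≠ m) (hy : IsCubicStep f ψ B (sigma m τ l) z y v)
      (hgrad : ¬ ‖gradient f y + v‖ ≤ ε)
      (hprog : ((ε ^ (3 / 2 : ℝ) / (384 * sigma m τ l ^ (1 / 2 : ℝ)) * (t + 1) : ℝ) : EReal)
        ≤ F f ψ x - F f ψ y) :
      Step f ψ τ₀ ε m (.inner k x τ l B t z)
        [.value z, .grad z, .grad y, .value x, .value y] (.inner k x τ l B (t + 1) y)
  /-- The new inner point `y` fails both tests: `CubicSteps` returns `halt`, and the main loop
  increases the adaptive search index. -/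
  | halt (k : ℕ) (x : E n) (τ : ℝ) (l : ℕ) (B : Matrix (Fin n) (Fin n) ℝ) (t : ℕ)
      (z y v : E n) (ht : t ≠ m) (hy : IsCubicStep f ψ B (sigma m τ l) z y v)
      (hgrad : ¬ ‖gradient f y + v‖ ≤ ε)
      (hprog : ¬ ((ε ^ (3 / 2 : ℝ) / (384 * sigma m τ l ^ (1 / 2 : ℝ)) * (t + 1) : ℝ) : EReal)
        ≤ F f ψ x - F f ψ y) :
      Step f ψ τ₀ ε m (.inner k x τ l B t z)
        [.value z, .grad z, .grad y, .value x, .value y] (.outer k x τ (l + 1))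

/-- The initial state: `k = 0`, the point `x₀`, `τ₀` and `l = 0`. -/
def State.init {n : ℕ} (x₀ : E n) (τ₀ : ℝ) : State n := .outer 0 x₀ τ₀ 0

/-- `Exec f ψ τ₀ ε m x₀ q s`: some finite execution of the method from `x₀` leads to state `s`,
and `q` is the list of all oracle calls made on the way. -/
inductive Exec {n : ℕ} (f : E n → ℝ) (ψ : E n → EReal) (τ₀ ε : ℝ) (m : ℕ) (x₀ : E n) :
    List (Query n) → State n → Prop
  | start : Exec f ψ τ₀ ε m x₀ [] (State.init x₀ τ₀)
  | step {q q' : List (Query n)} {s s' : State n} :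
      Exec f ψ τ₀ ε m x₀ q s → Step f ψ τ₀ ε m s q' s' → Exec f ψ τ₀ ε m x₀ (q ++ q') s'

end FirstOrderCNM

/-! The method is analysed through the decrease of `F` inside one call of `CubicSteps`, followed by
an amortized count of the oracle calls.

*One cubic step.* Let `r` be the length of a step from `z` to `y` and let `δ` bound the error of
`B` as an approximation of the Hessian at `z`. Taylor's formula with Lipschitz Hessian shows that
`F` decreases by at least `(σ - L) r³ / 6 - δ r² / 2`, and that the gradient test can fail only if
`ε ≤ σ r² + δ r`. Together (`IsCubicStep.decrease_of_not_stationary`) a step that fails the gradient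
test decreases `F` by at least `ε^{3/2} σ^{-1/2} / 192 + σ r³ / 48 - (128/3) δ³ / σ²`.

*One call.* `B` is formed once, at `x`, so `δ` is the finite-difference error plus `L ‖z - x‖`.
The finite-difference error is at most `√n L h / 2` (`norm_hessApprox_sub_hessian_le`), and `h` is
chosen so that it costs at most half of the first term. The cubes of the distances `‖z - x‖` are
bounded by `t²` times the sum of the cubes of the step lengths, and after summation over at most
`m` steps they are absorbed by the terms `σ r³ / 48`, because `σ³ = (8192/3) (2^ℓ τ m)³`. Hence for
`L ≤ 2^ℓ τ` the progress test never fails (`AccumulatedDecrease.step`, `AccumulatedDecrease.le`).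

*Counting.* Consequently `2^ℓ τ_k` never exceeds `2 max(τ₀, L)`. With `m = n` every successful call
decreases `F` by a multiple of `n · ε^{3/2} n^{-1/2}`, so there are `O(n^{-1/2} ε^{-3/2})` of them.
A halt doubles `2^ℓ τ_k` and a success at most halves it, so the number of all calls is at most twice
the number of successes plus a constant. Each call makes at most `7 n` evaluations
(`Invariant.step`, `Invariant.exists_count`).

*Existence of steps.* A proper closed convex function has a lower bound of linear growth, so the
cubic model plus `ψ` attains its minimum, and an exact minimizer is admissible
(`exists_isCubicStep`). -/

namespace FirstOrderCNM

variable {n : ℕ}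

/-! ### Taylor estimates for a function with Lipschitz Hessian -/

theorem contDiff_gradient {f : E n → ℝ} (hf : ContDiff ℝ 2 f) : ContDiff ℝ 1 (gradient f) := by
  have h : ContDiff ℝ 1 (fderiv ℝ f) := hf.fderiv_right (by norm_num)
  exact (InnerProductSpace.toDual ℝ (E n)).symm.toContinuousLinearEquiv.contDiff.comp h

theorem hasFDerivAt_gradient {f : E n → ℝ} (hf : ContDiff ℝ 2 f) (x : E n) :
    HasFDerivAt (gradient f) (hessian f x) x :=
  ((contDiff_gradient hf).differentiable (by norm_num) x).hasFDerivAt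

theorem hasGradientAt_of_contDiff {f : E n → ℝ} (hf : ContDiff ℝ 2 f) (x : E n) :
    HasGradientAt f (gradient f x) x :=
  (hf.differentiable (by norm_num) x).hasGradientAt

theorem inner_hessian {f : E n → ℝ} (hf : ContDiff ℝ 2 f) (x u v : E n) :
    inner ℝ (hessian f x u) v = fderiv ℝ (fderiv ℝ f) x u v := by
  have h : DifferentiableAt ℝ (fderiv ℝ f) x :=
    (hf.fderiv_right (m := 1) (by norm_num)).differentiable (by norm_num) x
  have h2 := ((InnerProductSpace.toDual ℝ (E n)).symm.toContinuousLinearEquiv.hasFDerivAt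
    (x := fderiv ℝ f x)).comp x h.hasFDerivAt
  have h3 : hessian f x = _ := h2.fderiv
  rw [h3]
  exact InnerProductSpace.toDual_symm_apply

theorem hessian_symmetric {f : E n → ℝ} (hf : ContDiff ℝ 2 f) (x u v : E n) :
    inner ℝ (hessian f x u) v = inner ℝ u (hessian f x v) := by
  rw [inner_hessian hf, real_inner_comm, inner_hessian hf]
  exact (hf.contDiffAt.isSymmSndFDerivAt (by simp)) u v

theorem norm_gradient_sub_le {f : E n → ℝ} {L : ℝ} (hf : ContDiff ℝ 2 f)
    (hL : HasLipschitzHessian f L) (x d : E n) :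
    ‖gradient f (x + d) - gradient f x - hessian f x d‖ ≤ L / 2 * ‖d‖ ^ 2 := by
  have hline : ∀ t : ℝ, HasDerivAt (fun t : ℝ => x + t • d) d t := fun t => by
    simpa using ((hasDerivAt_id t).smul_const d).const_add x
  have hder : ∀ t : ℝ, HasDerivAt
      (fun t : ℝ => gradient f (x + t • d) - gradient f x - t • hessian f x d)
      (hessian f (x + t • d) d - hessian f x d) t := fun t => by
    have h1 := (hasFDerivAt_gradient hf (x + t • d)).comp_hasDerivAt t (hline t)
    have h2 := (hasDerivAt_id t).smul_const (hessian f x d)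
    exact ((h1.sub_const (gradient f x)).sub h2).congr_deriv (by simp)
  have key := image_norm_le_of_norm_deriv_right_le_deriv_boundary (a := 0) (b := 1)
    (fun t _ => (hder t).continuousAt.continuousWithinAt)
    (fun t _ => (hder t).hasDerivWithinAt)
    (B := fun t => L * ‖d‖ ^ 2 * (t ^ 2 / 2)) (B' := fun t => L * ‖d‖ ^ 2 * t) (by simp)
    (fun t => by
      exact (((hasDerivAt_pow 2 t).div_const 2).const_mul (L * ‖d‖ ^ 2)).congr_deriv (by simp))
    (fun t ht => by
      rw [← sub_apply]
      refine (ContinuousLinearMap.le_opNorm _ _).trans ?_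
      have := hL x (x + t • d)
      rw [add_sub_cancel_left, norm_smul, Real.norm_of_nonneg ht.1] at this
      calc _ ≤ L * (t * ‖d‖) * ‖d‖ := by gcongr
        _ = _ := by ring) (x := 1) (by simp)
  simp only [one_smul] at key
  exact key.trans (le_of_eq (by ring))

theorem le_taylor_two_add_cube {f : E n → ℝ} {L : ℝ} (hf : ContDiff ℝ 2 f)
    (hL : HasLipschitzHessian f L) (x d : E n) :
    f (x + d) ≤ f x + inner ℝ (gradient f x) d + 1 / 2 * inner ℝ (hessian f x d) d
      + L / 6 * ‖d‖ ^ 3 := by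
  have hline : ∀ t : ℝ, HasDerivAt (fun t : ℝ => x + t • d) d t := fun t => by
    simpa using ((hasDerivAt_id t).smul_const d).const_add x
  have hder : ∀ t : ℝ, HasDerivAt
      (fun t : ℝ => f (x + t • d) - f x - t * inner ℝ (gradient f x) d
        - t ^ 2 / 2 * inner ℝ (hessian f x d) d)
      (inner ℝ (gradient f (x + t • d) - gradient f x - hessian f x (t • d)) d) t := fun t => by
    have h1 := (hasGradientAt_of_contDiff hf (x + t • d)).hasFDerivAt.comp_hasDerivAt t (hline t)
    have h2 := (hasDerivAt_id t).mul_const (inner ℝ (gradient f x) d)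
    have h3 := ((hasDerivAt_pow 2 t).div_const 2).mul_const (inner ℝ (hessian f x d) d)
    refine (((h1.sub_const (f x)).sub h2).sub h3).congr_deriv ?_
    simp [inner_sub_left, inner_smul_left]
  have key := image_norm_le_of_norm_deriv_right_le_deriv_boundary (a := 0) (b := 1)
    (fun t _ => (hder t).continuousAt.continuousWithinAt)
    (fun t _ => (hder t).hasDerivWithinAt)
    (B := fun t => L / 2 * ‖d‖ ^ 3 * (t ^ 3 / 3)) (B' := fun t => L / 2 * ‖d‖ ^ 3 * t ^ 2)
    (by simp)
    (fun t => by
      exact (((hasDerivAt_pow 3 t).div_const 3).const_mul (L / 2 * ‖d‖ ^ 3)).congr_deriv (by simp))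
    (fun t ht => by
      refine (norm_inner_le_norm _ _).trans ?_
      have := norm_gradient_sub_le hf hL x (t • d)
      rw [norm_smul, Real.norm_of_nonneg ht.1] at this
      calc _ ≤ L / 2 * (t * ‖d‖) ^ 2 * ‖d‖ := by gcongr
        _ = _ := by ring) (x := 1) (by simp)
  simp only [one_smul, Real.norm_eq_abs] at key
  have := (abs_le.1 key).2
  linarith

/-! ### The gradient of the cubic model -/

theorem inner_toEuclideanLin_of_isSymm {B : Matrix (Fin n) (Fin n) ℝ} (hB : B.IsSymm) (u v : E n) :
    inner ℝ (Matrix.toEuclideanLin B u) v = inner ℝ u (Matrix.toEuclideanLin B v) := by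
  have h : B.IsHermitian := by
    rw [Matrix.IsHermitian, Matrix.conjTranspose_eq_transpose_of_trivial]; exact hB
  exact (Matrix.isSymmetric_toEuclideanLin_iff.2 h) u v

theorem hasGradientAt_model (f : E n → ℝ) {B : Matrix (Fin n) (Fin n) ℝ} (hB : B.IsSymm) (σ : ℝ)
    (x y : E n) :
    HasGradientAt (model f B σ x)
      (gradient f x + Matrix.toEuclideanLin B (y - x) + (σ / 2 * ‖y - x‖) • (y - x)) y := by
  have hsub : HasFDerivAt (fun y : E n => y - x) (ContinuousLinearMap.id ℝ (E n)) y :=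
    (hasFDerivAt_id y).sub_const x
  have hBsub : HasFDerivAt (fun y : E n => Matrix.toEuclideanCLM (𝕜 := ℝ) B (y - x))
      (Matrix.toEuclideanCLM (𝕜 := ℝ) B) y := by
    exact ((Matrix.toEuclideanCLM (𝕜 := ℝ) B).hasFDerivAt (x := y - x)).comp y hsub
  have h1 := (hasFDerivAt_const (gradient f x) y).inner ℝ hsub
  have h2 := hBsub.inner ℝ hsub
  have h3 := (hasFDerivAt_norm_rpow (y - x) (p := 3) (by norm_num)).comp y hsub
  have h := ((h1.const_add (f x)).add (h2.const_mul (1 / 2))).add (h3.const_mul (σ / 6))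
  rw [hasGradientAt_iff_hasFDerivAt]
  have e1 : model f B σ x = fun y => f x + inner ℝ (gradient f x) (y - x)
      + 1 / 2 * inner ℝ (Matrix.toEuclideanCLM (𝕜 := ℝ) B (y - x)) (y - x)
      + σ / 6 * ‖y - x‖ ^ (3 : ℝ) := by
    funext y
    norm_cast
  rw [e1]
  refine h.congr_fderiv ?_
  ext v
  have hsymm := inner_toEuclideanLin_of_isSymm hB (y - x) v
  have e2 : ∀ u, Matrix.toEuclideanCLM (𝕜 := ℝ) B u = Matrix.toEuclideanLin B u := fun u => rfl
  have e3 : inner ℝ (Matrix.toEuclideanLin B v) (y - x)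
      = inner ℝ (Matrix.toEuclideanLin B (y - x)) v := by
    rw [hsymm, real_inner_comm]
  have e4 : ‖y - x‖ ^ ((3 : ℝ) - 2) = ‖y - x‖ := by norm_num
  simp [e2, e3, e4, inner_sub_left] at e3 ⊢
  ring

theorem gradient_model (f : E n → ℝ) {B : Matrix (Fin n) (Fin n) ℝ} (hB : B.IsSymm) (σ : ℝ)
    (x y : E n) :
    gradient (model f B σ x) y
      = gradient f x + Matrix.toEuclideanLin B (y - x) + (σ / 2 * ‖y - x‖) • (y - x) :=
  (hasGradientAt_model f hB σ x y).gradient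

/-! ### The finite-difference Hessian approximation -/

theorem hessApprox_isSymm (f : E n → ℝ) (x : E n) (h : ℝ) : (hessApprox f x h).IsSymm := by
  unfold hessApprox Matrix.IsSymm
  rw [Matrix.transpose_smul, Matrix.transpose_add, Matrix.transpose_transpose, add_comm]

theorem toEuclideanCLM_diffMatrix_apply (f : E n → ℝ) (x : E n) (h : ℝ) (u : E n) :
    Matrix.toEuclideanCLM (𝕜 := ℝ) (diffMatrix f x h) u
      = ∑ j, u j • (h⁻¹ • (gradient f (x + h • e j) - gradient f x)) := by
  ext i
  rw [Matrix.ofLp_toEuclideanCLM]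
  simp only [Matrix.mulVec, dotProduct, diffMatrix, Matrix.of_apply, WithLp.ofLp_sum,
    Finset.sum_apply, PiLp.smul_apply, PiLp.sub_apply, smul_eq_mul]
  exact Finset.sum_congr rfl fun j _ => by ring

/-- Each column of the difference matrix has error at most `L h / 2`, and the columns combine by
the Cauchy–Schwarz inequality, at the price of a factor `√n`. -/
theorem norm_diffMatrix_sub_hessian_le {f : E n → ℝ} {L h : ℝ} (hf : ContDiff ℝ 2 f)
    (hL0 : 0 ≤ L) (hL : HasLipschitzHessian f L) (hh : 0 < h) (x : E n) :
    ‖Matrix.toEuclideanCLM (𝕜 := ℝ) (diffMatrix f x h) - hessian f x‖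
      ≤ √n * (L * h / 2) := by
  refine ContinuousLinearMap.opNorm_le_bound _ (by positivity) fun u => ?_
  have hu : u = ∑ j, u j • (e j : E n) := by
    ext i
    simp [e, Finset.sum_apply, Pi.single_apply]
  have hcol : ∀ j : Fin n,
      ‖h⁻¹ • (gradient f (x + h • e j) - gradient f x) - hessian f x (e j)‖ ≤ L * h / 2 := by
    intro j
    have h1 := norm_gradient_sub_le hf hL x (h • e j)
    have h2 : h⁻¹ • (gradient f (x + h • e j) - gradient f x) - hessian f x (e j)
        = h⁻¹ • (gradient f (x + h • e j) - gradient f x - hessian f x (h • e j)) := by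
      rw [map_smul, smul_sub _ _ (h • _), inv_smul_smul₀ hh.ne']
    have h3 : ‖(e j : E n)‖ = 1 := by simp [e]
    rw [norm_smul, h3, Real.norm_of_nonneg hh.le] at h1
    rw [h2, norm_smul, norm_inv, Real.norm_of_nonneg hh.le]
    calc _ ≤ h⁻¹ * (L / 2 * (h * 1) ^ 2) := by gcongr
      _ = _ := by field_simp
  have hsum : ∑ j, |u j| ≤ √n * ‖u‖ := by
    have h1 := sq_sum_le_card_mul_sum_sq (s := Finset.univ) (f := fun j => |u j|)
    rw [EuclideanSpace.norm_eq, ← Real.sqrt_mul (by positivity)]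
    apply Real.le_sqrt_of_sq_le
    simpa using h1
  have hsplit : (Matrix.toEuclideanCLM (𝕜 := ℝ) (diffMatrix f x h) - hessian f x) u
      = ∑ j, u j • (h⁻¹ • (gradient f (x + h • e j) - gradient f x) - hessian f x (e j)) := by
    rw [sub_apply, toEuclideanCLM_diffMatrix_apply]
    conv_lhs => rw [hu]
    simp only [map_sum, map_smul, smul_sub, Finset.sum_sub_distrib]
    rw [← hu]
  rw [hsplit]
  calc _ ≤ ∑ j, |u j| * (L * h / 2) := by
        refine norm_sum_le_of_le _ fun j _ => ?_
        rw [norm_smul, Real.norm_eq_abs]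
        gcongr
        exact hcol j
    _ = (∑ j, |u j|) * (L * h / 2) := by rw [Finset.sum_mul]
    _ ≤ (√n * ‖u‖) * (L * h / 2) := by gcongr
    _ = _ := by ring

/-- Symmetrization does not increase the error, because the Hessian is self-adjoint. -/
theorem norm_hessApprox_sub_hessian_le {f : E n → ℝ} {L h : ℝ} (hf : ContDiff ℝ 2 f)
    (hL0 : 0 ≤ L) (hL : HasLipschitzHessian f L) (hh : 0 < h) (x : E n) :
    ‖Matrix.toEuclideanCLM (𝕜 := ℝ) (hessApprox f x h) - hessian f x‖
      ≤ √n * (L * h / 2) := by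
  set T := Matrix.toEuclideanCLM (𝕜 := ℝ) (diffMatrix f x h) with hT
  have hH : star (hessian f x) = hessian f x := by
    rw [ContinuousLinearMap.star_eq_adjoint]
    symm
    rw [ContinuousLinearMap.eq_adjoint_iff]
    exact hessian_symmetric hf x
  have h1 : Matrix.toEuclideanCLM (𝕜 := ℝ) (hessApprox f x h) = (1 / 2 : ℝ) • (T + star T) := by
    rw [hT, ← map_star, Matrix.star_eq_conjTranspose,
      Matrix.conjTranspose_eq_transpose_of_trivial, ← map_add, ← map_smul]
    rfl
  have h2 := norm_diffMatrix_sub_hessian_le hf hL0 hL hh x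
  rw [← hT] at h2
  have h3 : ‖star T - hessian f x‖ ≤ √n * (L * h / 2) := by
    rw [← hH, ContinuousLinearMap.star_eq_adjoint, ContinuousLinearMap.star_eq_adjoint,
      ← map_sub, LinearIsometryEquiv.norm_map]
    exact h2
  have h4 : Matrix.toEuclideanCLM (𝕜 := ℝ) (hessApprox f x h) - hessian f x
      = (1 / 2 : ℝ) • ((T - hessian f x) + (star T - hessian f x)) := by
    rw [h1]; module
  rw [h4, norm_smul]
  have := norm_add_le (T - hessian f x) (star T - hessian f x)
  norm_num
  linarith

/-! ### Real values of the objective on its domain -/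

/-- The objective as a real number, meaningful on `dom ψ` only: off the domain `toReal` sends
`ψ x = ⊤` to `0`. -/
noncomputable def realF (f : E n → ℝ) (ψ : E n → EReal) (x : E n) : ℝ := f x + (ψ x).toReal

theorem IsProperClosedConvex.coe_toReal {ψ : E n → EReal} (hψ : IsProperClosedConvex ψ) {x : E n}
    (hx : x ∈ dom ψ) : ((ψ x).toReal : EReal) = ψ x :=
  EReal.coe_toReal hx (hψ.ne_bot x)

theorem IsProperClosedConvex.coe_realF {ψ : E n → EReal} (hψ : IsProperClosedConvex ψ)
    (f : E n → ℝ) {x : E n} (hx : x ∈ dom ψ) : F f ψ x = (realF f ψ x : EReal) := by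
  rw [F, realF, EReal.coe_add, hψ.coe_toReal hx]

theorem IsProperClosedConvex.le_sub_iff {ψ : E n → EReal} (hψ : IsProperClosedConvex ψ)
    (f : E n → ℝ) {x y : E n} (hx : x ∈ dom ψ) (hy : y ∈ dom ψ) (a : ℝ) :
    (a : EReal) ≤ F f ψ x - F f ψ y ↔ a ≤ realF f ψ x - realF f ψ y := by
  rw [hψ.coe_realF f hx, hψ.coe_realF f hy, ← EReal.coe_sub, EReal.coe_le_coe_iff]

theorem IsCubicStep.mem_dom {f : E n → ℝ} {ψ : E n → EReal} {B : Matrix (Fin n) (Fin n) ℝ} {σ : ℝ}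
    {x y v : E n} (h : IsCubicStep f ψ B σ x y v) : y ∈ dom ψ := h.subgradient.1

theorem IsCubicStep.model_add_le {f : E n → ℝ} {ψ : E n → EReal} {B : Matrix (Fin n) (Fin n) ℝ}
    {σ : ℝ} {x y v : E n} (hψ : IsProperClosedConvex ψ) (h : IsCubicStep f ψ B σ x y v)
    (hx : x ∈ dom ψ) : model f B σ x y + (ψ y).toReal ≤ realF f ψ x := by
  have := h.model_le
  rw [hψ.coe_realF f hx, ← hψ.coe_toReal h.mem_dom, ← EReal.coe_add, EReal.coe_le_coe_iff] at this
  exact this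

/-! ### Existence of exact minimizers of the cubic subproblem -/

theorem IsProperClosedConvex.lowerSemicontinuous {ψ : E n → EReal} (hψ : IsProperClosedConvex ψ) :
    LowerSemicontinuous ψ := by
  rw [lowerSemicontinuous_iff_isClosed_preimage]
  intro a
  induction a with
  | bot =>
    have : ψ ⁻¹' Set.Iic ⊥ = ∅ := by
      ext x; simpa using hψ.ne_bot x
    rw [this]; exact isClosed_empty
  | coe a => exact hψ.closed.preimage (continuous_id.prodMk continuous_const)
  | top => simp

/-- A proper closed convex function is bounded below by a function of linear growth: it is bounded
below on a unit ball by compactness, and convexity along rays from the centre propagates this. -/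
theorem IsProperClosedConvex.exists_linear_lower_bound {ψ : E n → EReal}
    (hψ : IsProperClosedConvex ψ) {z : E n} (hz : z ∈ dom ψ) :
    ∃ a : ℝ, 0 ≤ a ∧ ∀ p ∈ epigraph ψ, -a * (‖p.1 - z‖ + 1) ≤ p.2 := by
  obtain ⟨w, -, hw⟩ := LowerSemicontinuousOn.exists_isMinOn (s := Metric.closedBall z 1)
    ⟨z, by simp⟩ (isCompact_closedBall z 1) (hψ.lowerSemicontinuous.lowerSemicontinuousOn _)
  obtain ⟨c, -, hc⟩ := EReal.lt_iff_exists_real_btwn.1 (bot_lt_iff_ne_bot.2 (hψ.ne_bot w))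
  have hball : ∀ q ∈ epigraph ψ, q.1 ∈ Metric.closedBall z 1 → c ≤ q.2 := fun q hq hq1 =>
    EReal.coe_le_coe_iff.1 (hc.le.trans ((hw hq1).trans hq))
  set b := (ψ z).toReal with hb
  have hzb : (z, b) ∈ epigraph ψ := (hψ.coe_toReal hz).ge
  refine ⟨|c| + |b|, by positivity, fun p hp => ?_⟩
  have hc1 := neg_abs_le c
  have hb1 := le_abs_self b
  have hc0 := abs_nonneg c
  have hb0 := abs_nonneg b
  set r := ‖p.1 - z‖ with hr
  have hr0 : 0 ≤ r := norm_nonneg _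
  rcases le_total r 1 with h | h
  · have := hball p hp (by rw [mem_closedBall_iff_norm]; exact h)
    nlinarith
  · have hrpos : 0 < r := by linarith
    have hq := hψ.convex hzb hp (a := 1 - r⁻¹) (b := r⁻¹)
      (by rw [sub_nonneg]; exact inv_le_one_of_one_le₀ h) (by positivity) (by ring)
    have hmem : ((1 - r⁻¹) • (z, b) + r⁻¹ • p).1 ∈ Metric.closedBall z 1 := by
      rw [mem_closedBall_iff_norm]
      have : ((1 - r⁻¹) • (z, b) + r⁻¹ • p).1 - z = r⁻¹ • (p.1 - z) := by
        simp only [Prod.fst_add, Prod.smul_fst]; module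
      rw [this, norm_smul, norm_inv, Real.norm_of_nonneg hr0, ← hr, inv_mul_cancel₀ hrpos.ne']
    have h1 := hball _ hq hmem
    simp only [Prod.snd_add, Prod.smul_snd, smul_eq_mul] at h1
    have h2 : c * r ≤ (r - 1) * b + p.2 := by
      have := mul_le_mul_of_nonneg_right h1 hr0
      have e : ((1 - r⁻¹) * b + r⁻¹ * p.2) * r = (r - 1) * b + p.2 := by field_simp
      linarith
    nlinarith

theorem model_ge (f : E n → ℝ) (B : Matrix (Fin n) (Fin n) ℝ) (σ : ℝ) (z y : E n) :
    f z - ‖gradient f z‖ * ‖y - z‖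
      - ‖Matrix.toEuclideanCLM (𝕜 := ℝ) B‖ / 2 * ‖y - z‖ ^ 2 + σ / 6 * ‖y - z‖ ^ 3
      ≤ model f B σ z y := by
  have h1 := (abs_le.1 (abs_real_inner_le_norm (gradient f z) (y - z))).1
  have h2 := (abs_le.1 (abs_real_inner_le_norm (Matrix.toEuclideanLin B (y - z)) (y - z))).1
  have h3 : ‖Matrix.toEuclideanLin B (y - z)‖
      ≤ ‖Matrix.toEuclideanCLM (𝕜 := ℝ) B‖ * ‖y - z‖ :=
    (Matrix.toEuclideanCLM (𝕜 := ℝ) B).le_opNorm (y - z)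
  have h4 := mul_le_mul_of_nonneg_right h3 (norm_nonneg (y - z))
  unfold model
  nlinarith

theorem exists_cubic_dominates {s : ℝ} (hs : 0 < s) {p q c : ℝ} (hq : 0 ≤ q)
    (hc : 0 ≤ c) : ∃ R : ℝ, 0 ≤ R ∧ ∀ r, R ≤ r → p * r ^ 2 + q * r + c ≤ s * r ^ 3 := by
  refine ⟨max 1 ((p + q + c) / s), by positivity, fun r hr => ?_⟩
  have h1 : 1 ≤ r := (le_max_left _ _).trans hr
  have h2 : p + q + c ≤ r * s := (div_le_iff₀ hs).1 ((le_max_right _ _).trans hr)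
  have h3 : r ≤ r ^ 2 := by nlinarith
  calc p * r ^ 2 + q * r + c ≤ p * r ^ 2 + q * r ^ 2 + c * r ^ 2 := by
        have : c * 1 ≤ c * r ^ 2 := by gcongr; linarith
        have : q * r ≤ q * r ^ 2 := by gcongr
        linarith
    _ = (p + q + c) * r ^ 2 := by ring
    _ ≤ (r * s) * r ^ 2 := by gcongr
    _ = s * r ^ 3 := by ring

/-- The cubic model plus `ψ` attains its minimum, phrased on the epigraph of `ψ`, where the
objective is the continuous function `(y, s) ↦ M(y) + s`. -/
theorem exists_min_model_on_epigraph (f : E n → ℝ) {ψ : E n → EReal} (hψ : IsProperClosedConvex ψ)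
    {B : Matrix (Fin n) (Fin n) ℝ} (hB : B.IsSymm) {σ : ℝ} (hσ : 0 < σ) {z : E n}
    (hz : z ∈ dom ψ) :
    ∃ p ∈ epigraph ψ, ∀ q ∈ epigraph ψ, model f B σ z p.1 + p.2 ≤ model f B σ z q.1 + q.2 := by
  obtain ⟨a, ha0, ha⟩ := hψ.exists_linear_lower_bound hz
  have hcont : Continuous (model f B σ z) :=
    continuous_iff_continuousAt.2 fun y => (hasGradientAt_model f hB σ z y).continuousAt
  set b := (ψ z).toReal with hb
  have hzb : (z, b) ∈ epigraph ψ := (hψ.coe_toReal hz).ge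
  have hMz : model f B σ z z = f z := by simp [model]
  set G := ‖gradient f z‖
  set N := ‖Matrix.toEuclideanCLM (𝕜 := ℝ) B‖
  have hG : 0 ≤ G := norm_nonneg _
  have hN : 0 ≤ N := norm_nonneg _
  obtain ⟨R, hR0, hR⟩ := exists_cubic_dominates (s := σ / 6) (by positivity) (p := N / 2)
    (q := G + a) (c := a + |b|) (by positivity) (by positivity)
  have hbb := le_abs_self b
  refine ContinuousOn.exists_isMinOn' (f := fun p : E n × ℝ => model f B σ z p.1 + p.2)
    (x₀ := (z, b)) (by fun_prop) hψ.closed hzb ?_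
  set K : Set (E n × ℝ) := Metric.closedBall z R ×ˢ
    Set.Icc (-a * (R + 1)) (b + G * R + N / 2 * R ^ 2) with hK
  have hKc : IsCompact K := (isCompact_closedBall z R).prod isCompact_Icc
  rw [Filter.eventually_inf_principal]
  filter_upwards [hKc.compl_mem_cocompact] with p hpK hp
  have h1 := ha p hp
  have h2 := model_ge f B σ z p.1
  set r := ‖p.1 - z‖ with hr
  have hr0 : 0 ≤ r := norm_nonneg _
  show model f B σ z z + b ≤ model f B σ z p.1 + p.2
  rw [hMz]
  rcases le_total R r with h | h
  · have := hR r h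
    linarith
  · have h3 : b + G * R + N / 2 * R ^ 2 < p.2 := by
      by_contra hcon
      refine hpK ⟨by rw [mem_closedBall_iff_norm]; exact h, ?_, not_lt.1 hcon⟩
      nlinarith
    have h4 : G * r ≤ G * R := by gcongr
    have h5 : N / 2 * r ^ 2 ≤ N / 2 * R ^ 2 := by gcongr
    have h6 : 0 ≤ σ / 6 * r ^ 3 := by positivity
    linarith

/-- An exact minimizer of the subproblem is admissible: by convexity of `ψ` and differentiability
of the model, minus the gradient of the model is a subgradient of `ψ` there. -/
theorem exists_isCubicStep (f : E n → ℝ) {ψ : E n → EReal} (hψ : IsProperClosedConvex ψ)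
    {B : Matrix (Fin n) (Fin n) ℝ} (hB : B.IsSymm) {σ : ℝ} (hσ : 0 < σ) {z : E n}
    (hz : z ∈ dom ψ) : ∃ y v, IsCubicStep f ψ B σ z y v := by
  obtain ⟨⟨y, s⟩, hys, hmin⟩ := exists_min_model_on_epigraph f hψ hB hσ hz
  have hy : y ∈ dom ψ := fun h => by
    have h' : ψ y ≤ (s : EReal) := hys
    rw [h, top_le_iff] at h'
    exact EReal.coe_ne_top s h'
  have hs : s = (ψ y).toReal := by
    have h1 : (ψ y).toReal ≤ s := by
      rw [← EReal.coe_le_coe_iff, hψ.coe_toReal hy]; exact hys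
    have h2 := hmin (y, (ψ y).toReal) (hψ.coe_toReal hy).ge
    simp only at h2
    linarith
  have hgrad := hasGradientAt_model f hB σ z y
  rw [← gradient_model f hB] at hgrad
  set g := gradient (model f B σ z) y
  refine ⟨y, -g, ⟨hy, fun w => ?_⟩, ?_, ?_⟩
  · by_cases hw : w ∈ dom ψ
    swap
    · rw [show ψ w = ⊤ from not_not.1 hw]; exact le_top
    rw [← hψ.coe_toReal hy, ← hψ.coe_toReal hw, ← EReal.coe_add, EReal.coe_le_coe_iff]
    set t := (ψ w).toReal with ht
    have hline : HasDerivAt (fun θ : ℝ => y + θ • (w - y)) (w - y) 0 := by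
      simpa using ((hasDerivAt_id (0 : ℝ)).smul_const (w - y)).const_add y
    have hg0 : HasFDerivAt (model f B σ z) (InnerProductSpace.toDual ℝ (E n) g)
        (y + (0 : ℝ) • (w - y)) := by
      rw [zero_smul, add_zero]; exact hgrad.hasFDerivAt
    have hder : HasDerivAt (fun θ : ℝ => model f B σ z (y + θ • (w - y)) + θ * (t - s))
        (inner ℝ g (w - y) + (t - s)) 0 := by
      refine ((hg0.comp_hasDerivAt (0 : ℝ) hline).add
        ((hasDerivAt_id (0 : ℝ)).mul_const (t - s))).congr_deriv ?_
      simp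
    have hpos : ∀ θ ∈ Set.Icc (0 : ℝ) 1, model f B σ z (y + (0 : ℝ) • (w - y)) + 0 * (t - s)
        ≤ model f B σ z (y + θ • (w - y)) + θ * (t - s) := by
      intro θ hθ
      have hq := hψ.convex hys (show (w, t) ∈ epigraph ψ from (hψ.coe_toReal hw).ge)
        (sub_nonneg.2 hθ.2) hθ.1 (by ring)
      have := hmin _ hq
      have e1 : ((1 - θ) • (y, s) + θ • (w, t)).1 = y + θ • (w - y) := by
        simp only [Prod.fst_add, Prod.smul_fst]; module
      have e2 : ((1 - θ) • (y, s) + θ • (w, t)).2 = s + θ * (t - s) := by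
        simp only [Prod.snd_add, Prod.smul_snd, smul_eq_mul]; ring
      rw [e1, e2] at this
      simp only [zero_smul, add_zero, zero_mul] at this ⊢
      linarith
    have hge : 0 ≤ inner ℝ g (w - y) + (t - s) := by
      refine ge_of_tendsto
        ((hasDerivWithinAt_iff_tendsto_slope' Set.self_notMem_Ioi).1
          (hder.hasDerivWithinAt (s := Set.Ioi 0))) ?_
      filter_upwards [Ioo_mem_nhdsGT one_pos] with θ hθ
      rw [slope_def_field]
      exact div_nonneg (sub_nonneg.2 (hpos θ ⟨hθ.1.le, hθ.2.le⟩)) (by linarith [hθ.1])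
    rw [inner_neg_left, ← hs]
    linarith
  · have h := hmin (z, (ψ z).toReal) (hψ.coe_toReal hz).ge
    simp only [hs] at h
    rw [hψ.coe_realF f hz, ← hψ.coe_toReal hy, ← EReal.coe_add, EReal.coe_le_coe_iff, realF]
    simpa [model] using h
  · rw [add_neg_cancel, norm_zero]
    positivity

/-! ### Decrease of the objective in one cubic step -/

/-- The error of `B` as an approximation of the Hessian at a point `z` away from the point `x` at
which `B` was formed. -/
theorem norm_hessApprox_sub_hessian_apply_le {f : E n → ℝ} {L h : ℝ} (hf : ContDiff ℝ 2 f)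
    (hL0 : 0 ≤ L) (hL : HasLipschitzHessian f L) (hh : 0 < h) (x z u : E n) :
    ‖Matrix.toEuclideanLin (hessApprox f x h) u - hessian f z u‖
      ≤ (√n * (L * h / 2) + L * ‖z - x‖) * ‖u‖ := by
  have h1 := norm_hessApprox_sub_hessian_le hf hL0 hL hh x
  have h2 := hL z x
  rw [norm_sub_rev x z] at h2
  have h3 : Matrix.toEuclideanLin (hessApprox f x h) u - hessian f z u
      = (Matrix.toEuclideanCLM (𝕜 := ℝ) (hessApprox f x h) - hessian f x) u
        + (hessian f x - hessian f z) u := by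
    simp only [sub_apply]
    rw [sub_add_sub_cancel]
    rfl
  rw [h3]
  calc _ ≤ ‖(Matrix.toEuclideanCLM (𝕜 := ℝ) (hessApprox f x h) - hessian f x) u‖
        + ‖(hessian f x - hessian f z) u‖ := norm_add_le _ _
    _ ≤ ‖Matrix.toEuclideanCLM (𝕜 := ℝ) (hessApprox f x h) - hessian f x‖ * ‖u‖
        + ‖hessian f x - hessian f z‖ * ‖u‖ :=
      add_le_add (ContinuousLinearMap.le_opNorm _ _) (ContinuousLinearMap.le_opNorm _ _)
    _ ≤ _ := by rw [add_mul]; gcongr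

/-- If `B` approximates the Hessian at `z` up to `δ`, a cubic step of length `r` decreases the
objective by at least `(σ - L) r³ / 6 - δ r² / 2`. -/
theorem IsCubicStep.decrease {f : E n → ℝ} {ψ : E n → EReal} {B : Matrix (Fin n) (Fin n) ℝ}
    {σ L δ : ℝ} {z y v : E n} (hf : ContDiff ℝ 2 f) (hL : HasLipschitzHessian f L)
    (hψ : IsProperClosedConvex ψ) (hz : z ∈ dom ψ) (h : IsCubicStep f ψ B σ z y v)
    (hδ : ∀ u, ‖Matrix.toEuclideanLin B u - hessian f z u‖ ≤ δ * ‖u‖) :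
    (σ - L) / 6 * ‖y - z‖ ^ 3 - δ / 2 * ‖y - z‖ ^ 2 ≤ realF f ψ z - realF f ψ y := by
  have h1 := h.model_add_le hψ hz
  have h2 := le_taylor_two_add_cube hf hL z (y - z)
  rw [add_sub_cancel] at h2
  have h3 := (abs_le.1 (abs_real_inner_le_norm
    (Matrix.toEuclideanLin B (y - z) - hessian f z (y - z)) (y - z))).1
  have h4 := mul_le_mul_of_nonneg_right (hδ (y - z)) (norm_nonneg (y - z))
  rw [inner_sub_left] at h3
  unfold model at h1
  rw [realF.eq_1 f ψ y]
  nlinarith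

theorem IsCubicStep.norm_gradient_add_le {f : E n → ℝ} {ψ : E n → EReal}
    {B : Matrix (Fin n) (Fin n) ℝ} (hB : B.IsSymm)
    {σ L δ : ℝ} (hσ : 0 ≤ σ) {z y v : E n} (hf : ContDiff ℝ 2 f) (hL : HasLipschitzHessian f L)
    (h : IsCubicStep f ψ B σ z y v)
    (hδ : ∀ u, ‖Matrix.toEuclideanLin B u - hessian f z u‖ ≤ δ * ‖u‖) :
    ‖gradient f y + v‖ ≤ (3 / 4 * σ + L / 2) * ‖y - z‖ ^ 2 + δ * ‖y - z‖ := by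
  have h1 := h.gradient_le
  have h2 := norm_gradient_sub_le hf hL z (y - z)
  rw [add_sub_cancel] at h2
  have h3 := hδ (y - z)
  have h4 : ‖(σ / 2 * ‖y - z‖) • (y - z)‖ = σ / 2 * ‖y - z‖ ^ 2 := by
    rw [norm_smul, Real.norm_of_nonneg (by positivity)]; ring
  have e : gradient f y + v = (gradient f y - gradient f z - hessian f z (y - z))
      - (Matrix.toEuclideanLin B (y - z) - hessian f z (y - z))
      - (σ / 2 * ‖y - z‖) • (y - z) + (gradient (model f B σ z) y + v) := by
    rw [gradient_model f hB]; abel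
  rw [e]
  refine (norm_add_le _ _).trans ?_
  have h5 := norm_sub_le ((gradient f y - gradient f z - hessian f z (y - z))
      - (Matrix.toEuclideanLin B (y - z) - hessian f z (y - z))) ((σ / 2 * ‖y - z‖) • (y - z))
  have h6 := norm_sub_le (gradient f y - gradient f z - hessian f z (y - z))
      (Matrix.toEuclideanLin B (y - z) - hessian f z (y - z))
  linarith

/-- Normalized (`σ = 1`) trade-off between the cubic decrease, the gradient size `w ^ 2` and the
relative Hessian error `g`. -/
theorem cubic_tradeoff {r g w : ℝ} (hr : 0 ≤ r) (hg : 0 ≤ g) (hw : 0 ≤ w)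
    (h : w ^ 2 ≤ r ^ 2 + g * r) :
    w ^ 3 / 192 + r ^ 3 / 48 - 128 / 3 * g ^ 3 ≤ r ^ 3 / 7 - g / 2 * r ^ 2 := by
  have h1 : w ≤ r + g := by
    refine le_of_sq_le_sq ?_ (by positivity)
    nlinarith
  have h2 : w ^ 3 ≤ 4 * (r ^ 3 + g ^ 3) := by
    calc w ^ 3 ≤ (r + g) ^ 3 := by gcongr
      _ ≤ 2 ^ (3 - 1) * (r ^ 3 + g ^ 3) := add_pow_le hr hg 3
      _ = _ := by norm_num
  -- `r ^ 3 / 10 - g * r ^ 2 / 2 + 42 * g ^ 3` is nonnegative; its minimum in `r` is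
  -- near `3 g`, where the squares below vanish
  nlinarith [mul_nonneg hr (sq_nonneg (r - 3 * g)), mul_nonneg hg (sq_nonneg (r - 3 * g)),
    mul_nonneg hg (sq_nonneg r), pow_nonneg hg 3, pow_nonneg hr 3, mul_nonneg hr (sq_nonneg g)]

theorem rpow_three_halves_div_sqrt {ε σ : ℝ} (hε : 0 ≤ ε) (hσ : 0 < σ) :
    ε ^ (3 / 2 : ℝ) / σ ^ (1 / 2 : ℝ) = σ * √(ε / σ) ^ 3 := by
  have h1 : ε ^ (3 / 2 : ℝ) = √ε ^ 3 := by
    rw [Real.sqrt_eq_rpow, ← Real.rpow_mul_natCast hε]; norm_num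
  have h2 : σ = √σ ^ 2 := (Real.sq_sqrt hσ.le).symm
  have h3 : 0 < √σ := Real.sqrt_pos.2 hσ
  rw [h1, ← Real.sqrt_eq_rpow, Real.sqrt_div hε, div_pow]
  nth_rw 2 [h2]
  field_simp

/-- A step that does not reach an approximate solution decreases the objective by an amount of
order `ε^{3/2} σ^{-1/2}` and of order `σ r³`, up to an error of order `δ³ σ^{-2}`. -/
theorem IsCubicStep.decrease_of_not_stationary {f : E n → ℝ} {ψ : E n → EReal}
    {B : Matrix (Fin n) (Fin n) ℝ} (hB : B.IsSymm) {σ L δ ε : ℝ} (hσ : 0 < σ) (hLσ : 13 * L ≤ σ)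
    (hδ0 : 0 ≤ δ) (hε : 0 < ε) {z y v : E n} (hf : ContDiff ℝ 2 f)
    (hL : HasLipschitzHessian f L) (hψ : IsProperClosedConvex ψ) (hz : z ∈ dom ψ)
    (h : IsCubicStep f ψ B σ z y v)
    (hδ : ∀ u, ‖Matrix.toEuclideanLin B u - hessian f z u‖ ≤ δ * ‖u‖)
    (hgrad : ε < ‖gradient f y + v‖) :
    ε ^ (3 / 2 : ℝ) / σ ^ (1 / 2 : ℝ) / 192 + σ / 48 * ‖y - z‖ ^ 3 - 128 / 3 * δ ^ 3 / σ ^ 2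
      ≤ realF f ψ z - realF f ψ y := by
  have h1 := h.decrease hf hL hψ hz hδ
  have h2 := h.norm_gradient_add_le hB hσ.le hf hL hδ
  set r := ‖y - z‖
  have hr : 0 ≤ r := norm_nonneg _
  have hw : √(ε / σ) ^ 2 ≤ r ^ 2 + δ / σ * r := by
    rw [Real.sq_sqrt (by positivity), div_le_iff₀ hσ]
    have e : (r ^ 2 + δ / σ * r) * σ = σ * r ^ 2 + δ * r := by field_simp
    rw [e]
    nlinarith [mul_nonneg hσ.le (sq_nonneg r), mul_le_mul_of_nonneg_right hLσ (sq_nonneg r)]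
  have h3 := cubic_tradeoff hr (div_nonneg hδ0 hσ.le) (Real.sqrt_nonneg _) hw
  have h4 := mul_le_mul_of_nonneg_left h3 hσ.le
  have e1 : σ * (r ^ 3 / 7 - δ / σ / 2 * r ^ 2) = σ * r ^ 3 / 7 - δ / 2 * r ^ 2 := by field_simp
  have e2 : σ * (√(ε / σ) ^ 3 / 192 + r ^ 3 / 48 - 128 / 3 * (δ / σ) ^ 3)
      = σ * √(ε / σ) ^ 3 / 192 + σ / 48 * r ^ 3 - 128 / 3 * δ ^ 3 / σ ^ 2 := by field_simp
  rw [rpow_three_halves_div_sqrt hε.le hσ]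
  rw [e1, e2] at h4
  have h5 : σ * r ^ 3 / 7 ≤ (σ - L) / 6 * r ^ 3 := by
    nlinarith [mul_nonneg hσ.le (pow_nonneg hr 3), mul_le_mul_of_nonneg_right hLσ (pow_nonneg hr 3)]
  linarith

/-! ### Size of the parameters -/

theorem sigma_pos {m : ℕ} (hm : 1 ≤ m) {τ : ℝ} (hτ : 0 < τ) (l : ℕ) : 0 < sigma m τ l := by
  unfold sigma
  have : (0 : ℝ) < m := by exact_mod_cast hm
  positivity

theorem sigma_pow_three (m : ℕ) (τ : ℝ) (l : ℕ) :
    sigma m τ l ^ 3 = 8192 / 3 * (2 ^ l * τ * m) ^ 3 := by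
  have h : ((2 / 3 : ℝ) ^ (1 / 3 : ℝ)) ^ 3 = 2 / 3 := by
    rw [← Real.rpow_mul_natCast (by norm_num)]; norm_num
  unfold sigma
  calc _ = 4096 * ((2 / 3 : ℝ) ^ (1 / 3 : ℝ)) ^ 3 * (2 ^ l * τ * m) ^ 3 := by ring
    _ = _ := by rw [h]; ring

/-- The factor `2⁴ (2/3)^{1/3}` in `σ` exceeds `13`. -/
theorem thirteen_mul_le_sigma {m : ℕ} (hm : 1 ≤ m) {τ L : ℝ} (hτ : 0 < τ) {l : ℕ}
    (hL : L ≤ 2 ^ l * τ) : 13 * L ≤ sigma m τ l := by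
  have hm' : (1 : ℝ) ≤ m := by exact_mod_cast hm
  have hM : 0 < 2 ^ l * τ := by positivity
  refine (mul_le_mul_of_nonneg_left hL (by norm_num)).trans ?_
  refine le_of_pow_le_pow_left₀ (n := 3) (by norm_num) (sigma_pos hm hτ l).le ?_
  rw [sigma_pow_three, mul_pow, mul_pow _ (m : ℝ)]
  have : (2 ^ l * τ) ^ 3 * 1 ≤ (2 ^ l * τ) ^ 3 * (m : ℝ) ^ 3 := by
    gcongr
    exact one_le_pow₀ hm'
  nlinarith [pow_pos hM 3]

theorem stepsize_pos {n m : ℕ} (hn : 1 ≤ n) (hm : 1 ≤ m) {ε τ : ℝ} (hε : 0 < ε) (hτ : 0 < τ)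
    (l : ℕ) : 0 < stepsize n m ε τ l := by
  have := sigma_pos hm hτ l
  have : (0 : ℝ) < n := by exact_mod_cast hn
  unfold stepsize
  positivity

/-- The finite-difference error is small compared with the decrease that the progress test asks
for. -/
theorem finite_difference_error_le {n m : ℕ} (hn : 1 ≤ n) (hm : 1 ≤ m) {ε τ L : ℝ} (hε : 0 < ε)
    (hτ : 0 < τ) (hL0 : 0 ≤ L) {l : ℕ} (hL : L ≤ 2 ^ l * τ) :
    (√n * (L * stepsize n m ε τ l / 2)) ^ 3
      ≤ ε ^ (3 / 2 : ℝ) / sigma m τ l ^ (1 / 2 : ℝ) * sigma m τ l ^ 2 / 65536 := by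
  have hσ := sigma_pos hm hτ l
  have hn' : (0 : ℝ) < n := by exact_mod_cast hn
  set M := 2 ^ l * τ with hM
  have hM0 : 0 < M := by positivity
  have h1 : stepsize n m ε τ l ^ 3 = 3 * sigma m τ l ^ (3 / 2 : ℝ) * ε ^ (3 / 2 : ℝ)
      / (2 ^ 7 * 192 * (n : ℝ) ^ (3 / 2 : ℝ) * M ^ 3) := by
    unfold stepsize
    rw [← hM, ← Real.rpow_mul_natCast (by positivity)]
    norm_num
  have h2 : √(n : ℝ) ^ 3 = (n : ℝ) ^ (3 / 2 : ℝ) := by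
    rw [Real.sqrt_eq_rpow, ← Real.rpow_mul_natCast hn'.le]; norm_num
  have h3 : sigma m τ l ^ (3 / 2 : ℝ) * sigma m τ l ^ (1 / 2 : ℝ) = sigma m τ l ^ 2 := by
    rw [← Real.rpow_add hσ]; norm_num
  have hs : 0 < sigma m τ l ^ (1 / 2 : ℝ) := by positivity
  have he : 0 < ε ^ (3 / 2 : ℝ) := by positivity
  have h4 : ε ^ (3 / 2 : ℝ) / sigma m τ l ^ (1 / 2 : ℝ) * sigma m τ l ^ 2
      = sigma m τ l ^ (3 / 2 : ℝ) * ε ^ (3 / 2 : ℝ) := by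
    rw [← h3]; field_simp
  have hnp : 0 < (n : ℝ) ^ (3 / 2 : ℝ) := by positivity
  have hsp : 0 < sigma m τ l ^ (3 / 2 : ℝ) := by positivity
  have h5 : (√n * (L * stepsize n m ε τ l / 2)) ^ 3
      = (L / M) ^ 3 * (sigma m τ l ^ (3 / 2 : ℝ) * ε ^ (3 / 2 : ℝ) / 65536) := by
    calc _ = √(n : ℝ) ^ 3 * L ^ 3 * stepsize n m ε τ l ^ 3 / 8 := by ring
      _ = _ := by rw [h1, h2]; field_simp; ring
  rw [h5, h4]
  have h6 : (L / M) ^ 3 ≤ 1 := pow_le_one₀ (by positivity) ((div_le_one hM0).2 hL)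
  exact mul_le_of_le_one_left (by positivity) h6

/-! ### Accumulated decrease inside `CubicSteps` -/

/-- What the first `t` steps of `CubicSteps`, from `x` to `z`, have achieved when `σ` is large
enough. The number `S` stands for the sum of the cubes of the step lengths; the cubes of the
distances to `x` spoil only a part `O(L³ t³ σ⁻²)` of the gain `σ S / 48`. -/
def AccumulatedDecrease (f : E n → ℝ) (ψ : E n → EReal) (L ε σ : ℝ) (x : E n) (t : ℕ)
    (z : E n) : Prop :=
  ∃ S : ℝ, 0 ≤ S ∧ ‖z - x‖ ^ 3 ≤ (t : ℝ) ^ 2 * S ∧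
    t * (ε ^ (3 / 2 : ℝ) / σ ^ (1 / 2 : ℝ) / 384)
      + (σ / 48 - 512 / 3 * L ^ 3 / σ ^ 2 * ((t : ℝ) ^ 3 / 3)) * S ≤ realF f ψ x - realF f ψ z

theorem accumulatedDecrease_zero (f : E n → ℝ) (ψ : E n → EReal) (L ε σ : ℝ) (x : E n) :
    AccumulatedDecrease f ψ L ε σ x 0 x :=
  ⟨0, le_rfl, by simp, by simp⟩

/-- Induction step for the power mean bound `(∑ i < t, rᵢ) ^ 3 ≤ t ^ 2 * ∑ i < t, rᵢ ^ 3`. -/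
theorem add_pow_three_le {d r t S : ℝ} (hd : 0 ≤ d) (hr : 0 ≤ r) (ht : 0 ≤ t)
    (hS : 0 ≤ S) (h : d ^ 3 ≤ t ^ 2 * S) : (d + r) ^ 3 ≤ (t + 1) ^ 2 * (S + r ^ 3) := by
  rcases ht.eq_or_lt with rfl | ht
  · have hd0 : d = 0 := by
      have : d ^ 3 = 0 := le_antisymm (by simpa using h) (by positivity)
      exact pow_eq_zero_iff (by norm_num) |>.1 this
    subst hd0
    nlinarith
  · obtain ⟨a, rfl⟩ : ∃ a, d = t * a := ⟨d / t, by field_simp⟩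
    have ha : 0 ≤ a := nonneg_of_mul_nonneg_right hd ht
    have haS : t * a ^ 3 ≤ S := by
      have : t ^ 2 * (t * a ^ 3) ≤ t ^ 2 * S := by linarith [mul_pow t a 3]
      exact le_of_mul_le_mul_left this (by positivity)
    have h1 : (t + 1) ^ 2 * (t * a ^ 3 + r ^ 3) - (t * a + r) ^ 3
        = t * (a - r) ^ 2 * ((2 * t + 1) * a + (t + 2) * r) := by ring
    have h2 : 0 ≤ t * (a - r) ^ 2 * ((2 * t + 1) * a + (t + 2) * r) := by positivity
    have h3 : (t + 1) ^ 2 * (t * a ^ 3) ≤ (t + 1) ^ 2 * S := by gcongr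
    linarith

theorem AccumulatedDecrease.step {f : E n → ℝ} {ψ : E n → EReal} {L ε τ : ℝ} {m l t : ℕ}
    {x z y v : E n} (hn : 1 ≤ n) (hm : 1 ≤ m) (hL0 : 0 ≤ L) (hε : 0 < ε) (hτ : 0 < τ)
    (hLM : L ≤ 2 ^ l * τ) (hf : ContDiff ℝ 2 f) (hL : HasLipschitzHessian f L)
    (hψ : IsProperClosedConvex ψ) (hz : z ∈ dom ψ)
    (h : IsCubicStep f ψ (hessApprox f x (stepsize n m ε τ l)) (sigma m τ l) z y v)
    (hgrad : ¬ ‖gradient f y + v‖ ≤ ε)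
    (hacc : AccumulatedDecrease f ψ L ε (sigma m τ l) x t z) :
    AccumulatedDecrease f ψ L ε (sigma m τ l) x (t + 1) y := by
  obtain ⟨S, hS0, hS, hdec⟩ := hacc
  have hσ := sigma_pos hm hτ l
  have hh := stepsize_pos hn hm hε hτ l
  have hη := finite_difference_error_le hn hm hε hτ hL0 hLM
  set η := √n * (L * stepsize n m ε τ l / 2) with hη_def
  have hη0 : 0 ≤ η := by positivity
  have hstep := h.decrease_of_not_stationary (hessApprox_isSymm _ _ _) hσ
    (thirteen_mul_le_sigma hm hτ hLM) (δ := η + L * ‖z - x‖) (by positivity) hε hf hL hψ hz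
    (norm_hessApprox_sub_hessian_apply_le hf hL0 hL hh x z) (not_le.1 hgrad)
  set σ := sigma m τ l
  set P := ε ^ (3 / 2 : ℝ) / σ ^ (1 / 2 : ℝ) with hP
  set d := ‖z - x‖
  set r := ‖y - z‖
  have hd : 0 ≤ d := norm_nonneg _
  have hr : 0 ≤ r := norm_nonneg _
  have hδ : 128 / 3 * (η + L * d) ^ 3 / σ ^ 2
      ≤ P / 384 + 512 / 3 * L ^ 3 / σ ^ 2 * ((t : ℝ) ^ 2 * S) := by
    have h1 : (η + L * d) ^ 3 ≤ 4 * (P * σ ^ 2 / 65536 + L ^ 3 * ((t : ℝ) ^ 2 * S)) := by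
      calc (η + L * d) ^ 3 ≤ 2 ^ (3 - 1) * (η ^ 3 + (L * d) ^ 3) :=
            add_pow_le hη0 (by positivity) 3
        _ = 4 * (η ^ 3 + L ^ 3 * d ^ 3) := by rw [mul_pow L d]; norm_num
        _ ≤ _ := by gcongr
    calc _ ≤ 128 / 3 * (4 * (P * σ ^ 2 / 65536 + L ^ 3 * ((t : ℝ) ^ 2 * S))) / σ ^ 2 := by gcongr
      _ = _ := by field_simp; ring
  refine ⟨S + r ^ 3, by positivity, ?_, ?_⟩
  · have h1 : ‖y - x‖ ≤ d + r := by
      have := norm_add_le (z - x) (y - z)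
      rwa [add_comm (z - x), sub_add_sub_cancel] at this
    push_cast
    exact (pow_le_pow_left₀ (norm_nonneg _) h1 3).trans
      (add_pow_three_le hd hr (Nat.cast_nonneg t) hS0 hS)
  · set κ := 512 / 3 * L ^ 3 / σ ^ 2 with hκ
    have hκ0 : 0 ≤ κ := by positivity
    have ht : (0 : ℝ) ≤ t := Nat.cast_nonneg t
    have h1 : κ * ((t : ℝ) ^ 3 / 3 + t ^ 2) * S ≤ κ * (((t : ℝ) + 1) ^ 3 / 3) * S := by
      gcongr
      nlinarith
    have h2 : 0 ≤ κ * (((t : ℝ) + 1) ^ 3 / 3) * r ^ 3 := by positivity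
    push_cast
    linarith

theorem AccumulatedDecrease.le {f : E n → ℝ} {ψ : E n → EReal} {L ε τ : ℝ} {m l t : ℕ}
    {x z : E n} (hm : 1 ≤ m) (ht : t ≤ m) (hL0 : 0 ≤ L) (hτ : 0 < τ) (hLM : L ≤ 2 ^ l * τ)
    (hacc : AccumulatedDecrease f ψ L ε (sigma m τ l) x t z) :
    ε ^ (3 / 2 : ℝ) / (384 * sigma m τ l ^ (1 / 2 : ℝ)) * t ≤ realF f ψ x - realF f ψ z := by
  obtain ⟨S, hS0, -, hdec⟩ := hacc
  have hσ := sigma_pos hm hτ l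
  have h3 := sigma_pow_three m τ l
  set σ := sigma m τ l
  have h1 : 512 / 3 * L ^ 3 / σ ^ 2 * ((t : ℝ) ^ 3 / 3) ≤ σ / 48 := by
    have h2 : (L * t) ^ 3 ≤ (2 ^ l * τ * m) ^ 3 := by gcongr
    calc _ = 512 / 9 * (L * t) ^ 3 / σ ^ 2 := by ring
      _ ≤ 512 / 9 * (2 ^ l * τ * m) ^ 3 / σ ^ 2 := by gcongr
      _ = σ ^ 3 / 48 / σ ^ 2 := by rw [h3]; ring
      _ = σ / 48 := by field_simp
  have h4 := mul_nonneg (sub_nonneg.2 h1) hS0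
  have h5 : ε ^ (3 / 2 : ℝ) / (384 * σ ^ (1 / 2 : ℝ)) * t
      = t * (ε ^ (3 / 2 : ℝ) / σ ^ (1 / 2 : ℝ) / 384) := by
    rw [mul_comm 384, ← div_div, mul_comm]
  rw [h5]
  linarith

/-! ### Counting oracle calls -/

/-- The largest value that `2 ^ l * τ_k` takes in an execution. -/
noncomputable def maxTau (L τ₀ : ℝ) : ℝ := 2 * max τ₀ L

/-- The constant factor `2⁴ (2/3)^{1/3}` in `σ_{k,ℓ}`. -/
noncomputable def sigmaFactor : ℝ := 2 ^ 4 * (2 / 3 : ℝ) ^ (1 / 3 : ℝ)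

/-- A lower bound, valid for all `σ` that occur in an execution, on the decrease per inner step
that the progress test asks for. -/
noncomputable def minDecrease (n : ℕ) (L τ₀ ε : ℝ) : ℝ :=
  ε ^ (3 / 2 : ℝ) / (384 * (sigmaFactor * maxTau L τ₀ * n) ^ (1 / 2 : ℝ))

theorem sigmaFactor_pos : 0 < sigmaFactor := by unfold sigmaFactor; positivity

theorem two_mul_initial_le_maxTau (L τ₀ : ℝ) : 2 * τ₀ ≤ maxTau L τ₀ := by
  unfold maxTau; gcongr; exact le_max_left _ _

theorem two_mul_lipschitz_le_maxTau (L τ₀ : ℝ) : 2 * L ≤ maxTau L τ₀ := by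
  unfold maxTau; gcongr; exact le_max_right _ _

theorem minDecrease_pos (hn : 1 ≤ n) {L τ₀ ε : ℝ} (hτ₀ : 0 < τ₀) (hε : 0 < ε) :
    0 < minDecrease n L τ₀ ε := by
  have h1 := two_mul_initial_le_maxTau L τ₀
  have h2 : 0 < maxTau L τ₀ := by linarith
  have h3 := sigmaFactor_pos
  have h4 : (0 : ℝ) < n := by exact_mod_cast hn
  unfold minDecrease
  positivity

theorem minDecrease_le (hn : 1 ≤ n) {L τ₀ ε τ : ℝ} (hε : 0 < ε) (hτ : 0 < τ) {l : ℕ}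
    (hM : 2 ^ l * τ ≤ maxTau L τ₀) :
    minDecrease n L τ₀ ε ≤ ε ^ (3 / 2 : ℝ) / (384 * sigma n τ l ^ (1 / 2 : ℝ)) := by
  have hσ := sigma_pos hn hτ l
  have h3 := sigmaFactor_pos
  have h : sigma n τ l ≤ sigmaFactor * maxTau L τ₀ * n := by
    unfold sigma
    rw [show (2 : ℝ) ^ 4 * (2 / 3 : ℝ) ^ (1 / 3 : ℝ) = sigmaFactor from rfl]
    gcongr
  unfold minDecrease
  gcongr

/-- The invariant at the start of a call of `CubicSteps`, after `N` earlier calls. Each success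
adds one to `k` and at most halves `2 ^ l * τ`, each halt doubles `2 ^ l * τ`, so the number of
calls is bounded by `2 k + log₂ (2 ^ l τ / τ₀)`; and each success pays with `n` inner steps of
decrease. -/
structure OuterInvariant (f : E n → ℝ) (ψ : E n → EReal) (L τ₀ ε : ℝ) (x₀ : E n)
    (k : ℕ) (x : E n) (τ : ℝ) (l : ℕ) (N : ℝ) : Prop where
  mem_dom : x ∈ dom ψ
  tau_pos : 0 < τ
  le_maxTau : 2 ^ l * τ ≤ maxTau L τ₀
  decrease : k * (n * minDecrease n L τ₀ ε) ≤ realF f ψ x₀ - realF f ψ x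
  calls : N ≤ 2 * k + Real.logb 2 (2 ^ l * τ / τ₀)

/-- The invariant of an execution that has made `c` oracle calls. A completed call of `CubicSteps`
accounts for at most `(n + 1) + 5 n ≤ 7 n` of them. -/
def Invariant (f : E n → ℝ) (ψ : E n → EReal) (L τ₀ ε : ℝ) (x₀ : E n) (c : ℝ) : State n → Prop
  | .outer k x τ l => ∃ N, OuterInvariant f ψ L τ₀ ε x₀ k x τ l N ∧ c ≤ 7 * n * N
  | .inner k x τ l B t z => ∃ N, OuterInvariant f ψ L τ₀ ε x₀ k x τ l N ∧
      c ≤ 7 * n * N + (n + 1) + 5 * t ∧ t ≤ n ∧ z ∈ dom ψ ∧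
      B = hessApprox f x (stepsize n n ε τ l) ∧
      ε ^ (3 / 2 : ℝ) / (384 * sigma n τ l ^ (1 / 2 : ℝ)) * t ≤ realF f ψ x - realF f ψ z ∧
      (L ≤ 2 ^ l * τ → AccumulatedDecrease f ψ L ε (sigma n τ l) x t z)
  | .stopped _ y => IsApproxStationary f ψ ε y ∧ ∃ k x τ l N,
      OuterInvariant f ψ L τ₀ ε x₀ k x τ l N ∧ c ≤ 7 * n * (N + 1)

theorem invariant_init (f : E n → ℝ) {ψ : E n → EReal} {L τ₀ : ℝ} (hτ₀ : 0 < τ₀) (ε : ℝ)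
    {x₀ : E n} (hx₀ : x₀ ∈ dom ψ) : Invariant f ψ L τ₀ ε x₀ 0 (State.init x₀ τ₀) := by
  refine ⟨0, ⟨hx₀, hτ₀, ?_, by simp, ?_⟩, by simp⟩
  · have := two_mul_initial_le_maxTau L τ₀
    simp only [pow_zero, one_mul]
    linarith
  · simp [div_self hτ₀.ne']

theorem OuterInvariant.success {f : E n → ℝ} {ψ : E n → EReal} {L τ₀ ε : ℝ} {x₀ : E n}
    {k : ℕ} {x z : E n} {τ : ℝ} {l : ℕ} {N : ℝ} (hn : 1 ≤ n) (hτ₀ : 0 < τ₀) (hε : 0 < ε)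
    (h : OuterInvariant f ψ L τ₀ ε x₀ k x τ l N) (hz : z ∈ dom ψ)
    (hdec : ε ^ (3 / 2 : ℝ) / (384 * sigma n τ l ^ (1 / 2 : ℝ)) * n
      ≤ realF f ψ x - realF f ψ z) :
    OuterInvariant f ψ L τ₀ ε x₀ (k + 1) z (max τ₀ ((2 : ℝ) ^ ((l : ℤ) - 1) * τ)) 0 (N + 1) := by
  have hM0 : 0 < 2 ^ l * τ := mul_pos (by positivity) h.tau_pos
  have hhalf : (2 : ℝ) ^ ((l : ℤ) - 1) * τ = 2 ^ l * τ / 2 := by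
    rw [zpow_sub_one₀ (by norm_num), zpow_natCast]; ring
  have h1 := two_mul_initial_le_maxTau L τ₀
  refine ⟨hz, lt_max_of_lt_left hτ₀, ?_, ?_, ?_⟩
  · have h2 := h.le_maxTau
    rw [pow_zero, one_mul, max_le_iff, hhalf]
    constructor <;> linarith
  · have h2 : minDecrease n L τ₀ ε * n ≤ _ :=
      mul_le_mul_of_nonneg_right (minDecrease_le hn hε h.tau_pos h.le_maxTau) (Nat.cast_nonneg n)
    have h3 := h.decrease
    push_cast
    linarith
  · have h2 := h.calls
    have h3 : Real.logb 2 (2 ^ l * τ / τ₀) - 1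
        ≤ Real.logb 2 (2 ^ 0 * max τ₀ ((2 : ℝ) ^ ((l : ℤ) - 1) * τ) / τ₀) := by
      rw [← Real.logb_self_eq_one (b := 2) (by norm_num), ← Real.logb_div (by positivity)
        (by norm_num), hhalf, pow_zero, one_mul]
      refine Real.logb_le_logb_of_le (by norm_num) (by positivity) ?_
      rw [div_right_comm]
      gcongr
      exact le_max_right _ _
    push_cast
    linarith

theorem OuterInvariant.halt {f : E n → ℝ} {ψ : E n → EReal} {L τ₀ ε : ℝ} {x₀ : E n}
    {k : ℕ} {x : E n} {τ : ℝ} {l : ℕ} {N : ℝ} (hτ₀ : 0 < τ₀)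
    (h : OuterInvariant f ψ L τ₀ ε x₀ k x τ l N) (hM : 2 ^ l * τ < L) :
    OuterInvariant f ψ L τ₀ ε x₀ k x τ (l + 1) (N + 1) := by
  have hM0 : 0 < 2 ^ l * τ := mul_pos (by positivity) h.tau_pos
  have h1 := two_mul_lipschitz_le_maxTau L τ₀
  refine ⟨h.mem_dom, h.tau_pos, ?_, h.decrease, ?_⟩
  · rw [pow_succ]; linarith
  · have h2 := h.calls
    have h3 : Real.logb 2 (2 ^ (l + 1) * τ / τ₀) = Real.logb 2 (2 ^ l * τ / τ₀) + 1 := by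
      rw [← Real.logb_self_eq_one (b := 2) (by norm_num), ← Real.logb_mul (by positivity)
        (by norm_num)]
      congr 1
      rw [pow_succ]; ring
    linarith

theorem Invariant.step {f : E n → ℝ} {ψ : E n → EReal} {L τ₀ ε : ℝ} {x₀ : E n} (hn : 1 ≤ n)
    (hL0 : 0 ≤ L) (hτ₀ : 0 < τ₀) (hε : 0 < ε) (hf : ContDiff ℝ 2 f)
    (hL : HasLipschitzHessian f L) (hψ : IsProperClosedConvex ψ) {c : ℝ} {s s' : State n}
    {q : List (Query n)} (h : Invariant f ψ L τ₀ ε x₀ c s) (hs : Step f ψ τ₀ ε n s q s') :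
    Invariant f ψ L τ₀ ε x₀ (c + q.length) s' := by
  have hn' : (1 : ℝ) ≤ n := by exact_mod_cast hn
  cases hs with
  | call k x τ l =>
    obtain ⟨N, hN, hc⟩ := h
    refine ⟨N, hN, ?_, Nat.zero_le _, hN.mem_dom, rfl, by simp, fun _ =>
      accumulatedDecrease_zero f ψ L ε _ x⟩
    simp only [hessQueries, List.length_cons, List.length_ofFn]
    push_cast
    linarith
  | success k x τ l B z =>
    obtain ⟨N, hN, hc, -, hz, -, hdec, -⟩ := h
    refine ⟨N + 1, hN.success hn hτ₀ hε hz hdec, ?_⟩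
    simp only [List.length_nil]
    push_cast
    linarith
  | solution k x τ l B t z y v ht hy hgrad =>
    obtain ⟨N, hN, hc, htn, hz, hB, hdec, hacc⟩ := h
    refine ⟨⟨v, hy.subgradient, hgrad⟩, k, x, τ, l, N, hN, ?_⟩
    have htn' : (t : ℝ) + 1 ≤ n := by exact_mod_cast lt_of_le_of_ne htn ht
    simp only [List.length_cons, List.length_nil]
    push_cast
    linarith
  | advance k x τ l B t z y v ht hy hgrad hprog =>
    obtain ⟨N, hN, hc, htn, hz, hB, hdec, hacc⟩ := h
    rw [hψ.le_sub_iff f hN.mem_dom hy.mem_dom] at hprog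
    subst hB
    refine ⟨N, hN, ?_, lt_of_le_of_ne htn ht, hy.mem_dom, rfl, by exact_mod_cast hprog,
      fun hLM => (hacc hLM).step hn hn hL0 hε hN.tau_pos hLM hf hL hψ hz hy hgrad⟩
    simp only [List.length_cons, List.length_nil]
    push_cast
    linarith
  | halt k x τ l B t z y v ht hy hgrad hprog =>
    obtain ⟨N, hN, hc, htn, hz, hB, hdec, hacc⟩ := h
    rw [hψ.le_sub_iff f hN.mem_dom hy.mem_dom] at hprog
    subst hB
    have hlt : t + 1 ≤ n := lt_of_le_of_ne htn ht
    -- for `L ≤ 2 ^ l * τ` the progress test cannot fail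
    have hM : 2 ^ l * τ < L := by
      by_contra hLM
      have hLM := not_lt.1 hLM
      have := ((hacc hLM).step hn hn hL0 hε hN.tau_pos hLM hf hL hψ hz hy hgrad).le hn hlt hL0
        hN.tau_pos hLM
      exact hprog (by exact_mod_cast this)
    refine ⟨N + 1, hN.halt hτ₀ hM, ?_⟩
    have htn' : (t : ℝ) + 1 ≤ n := by exact_mod_cast hlt
    simp only [List.length_cons, List.length_nil]
    push_cast
    linarith

theorem Exec.invariant {f : E n → ℝ} {ψ : E n → EReal} {L τ₀ ε : ℝ} {x₀ : E n} (hn : 1 ≤ n)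
    (hL0 : 0 ≤ L) (hτ₀ : 0 < τ₀) (hε : 0 < ε) (hf : ContDiff ℝ 2 f)
    (hL : HasLipschitzHessian f L) (hψ : IsProperClosedConvex ψ) (hx₀ : x₀ ∈ dom ψ)
    {s : State n} {q : List (Query n)} (h : Exec f ψ τ₀ ε n x₀ q s) :
    Invariant f ψ L τ₀ ε x₀ q.length s := by
  induction h with
  | start => simpa using invariant_init f hτ₀ ε hx₀
  | step _ hs ih =>
    rw [List.length_append, Nat.cast_add]
    exact ih.step hn hL0 hτ₀ hε hf hL hψ hs

/-- The method never gets stuck: a state without successor is a stopped one. -/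
theorem Invariant.exists_step_or_stopped {f : E n → ℝ} {ψ : E n → EReal} {L τ₀ ε : ℝ} {x₀ : E n}
    (hn : 1 ≤ n) (hψ : IsProperClosedConvex ψ) {c : ℝ} {s : State n}
    (h : Invariant f ψ L τ₀ ε x₀ c s) :
    (∃ q' s', Step f ψ τ₀ ε n s q' s') ∨
      ∃ (k : ℕ) (x : E n), s = State.stopped k x ∧ IsApproxStationary f ψ ε x := by
  cases s with
  | outer k x τ l => exact Or.inl ⟨_, _, Step.call k x τ l⟩
  | stopped k x => exact Or.inr ⟨k, x, rfl, h.1⟩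
  | inner k x τ l B t z =>
    left
    obtain ⟨N, hN, -, -, hz, hB, -, -⟩ := h
    by_cases ht : t = n
    · subst ht
      exact ⟨_, _, Step.success k x τ l B z⟩
    · obtain ⟨y, v, hy⟩ := exists_isCubicStep f hψ
        (hB ▸ hessApprox_isSymm f x (stepsize n n ε τ l)) (sigma_pos hn hN.tau_pos l) hz
      by_cases hgrad : ‖gradient f y + v‖ ≤ ε
      · exact ⟨_, _, Step.solution k x τ l B t z y v ht hy hgrad⟩
      · by_cases hprog : ((ε ^ (3 / 2 : ℝ) / (384 * sigma n τ l ^ (1 / 2 : ℝ)) * (t + 1) : ℝ) :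
            EReal) ≤ F f ψ x - F f ψ y
        · exact ⟨_, _, Step.advance k x τ l B t z y v ht hy hgrad hprog⟩
        · exact ⟨_, _, Step.halt k x τ l B t z y v ht hy hgrad hprog⟩

/-- In every state the number of oracle calls is bounded through the number `k` of successful
calls of `CubicSteps`, and `k` through the total decrease of the objective. -/
theorem Invariant.exists_count {f : E n → ℝ} {ψ : E n → EReal} {L τ₀ ε : ℝ} {x₀ : E n}
    (hn : 1 ≤ n) (hτ₀ : 0 < τ₀) {c : ℝ} {s : State n} (h : Invariant f ψ L τ₀ ε x₀ c s) :
    ∃ (k : ℕ) (x : E n), x ∈ dom ψ ∧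
      k * (n * minDecrease n L τ₀ ε) ≤ realF f ψ x₀ - realF f ψ x ∧
      c ≤ 7 * n * (2 * k + Real.logb 2 (maxTau L τ₀ / τ₀) + 1) := by
  have hn' : (1 : ℝ) ≤ n := by exact_mod_cast hn
  have key : ∃ k x τ l N, OuterInvariant f ψ L τ₀ ε x₀ k x τ l N ∧ c ≤ 7 * n * (N + 1) := by
    cases s with
    | outer k x τ l =>
      obtain ⟨N, hN, hc⟩ := h
      exact ⟨k, x, τ, l, N, hN, by linarith⟩
    | stopped k x => exact h.2
    | inner k x τ l B t z =>
      obtain ⟨N, hN, hc, htn, -⟩ := h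
      have htn' : (t : ℝ) ≤ n := by exact_mod_cast htn
      exact ⟨k, x, τ, l, N, hN, by linarith⟩
  obtain ⟨k, x, τ, l, N, hN, hc⟩ := key
  refine ⟨k, x, hN.mem_dom, hN.decrease, hc.trans ?_⟩
  have hM0 : 0 < 2 ^ l * τ := mul_pos (by positivity) hN.tau_pos
  have h1 := hN.calls
  have h2 : Real.logb 2 (2 ^ l * τ / τ₀) ≤ Real.logb 2 (maxTau L τ₀ / τ₀) := by
    refine Real.logb_le_logb_of_le (by norm_num) (by positivity) ?_
    gcongr
    exact hN.le_maxTau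
  gcongr
  linarith

theorem realF_sub_le {f : E n → ℝ} {ψ : E n → EReal} (hψ : IsProperClosedConvex ψ) {Δ : ℝ}
    {x₀ x : E n} (hx₀ : x₀ ∈ dom ψ) (hx : x ∈ dom ψ) (h : F f ψ x₀ - Fstar f ψ ≤ (Δ : EReal)) :
    realF f ψ x₀ - realF f ψ x ≤ Δ := by
  have h1 : Fstar f ψ ≤ F f ψ x := iInf₂_le x hx
  have h2 := (EReal.sub_le_sub le_rfl h1).trans h
  rwa [hψ.coe_realF f hx₀, hψ.coe_realF f hx, ← EReal.coe_sub, EReal.coe_le_coe_iff] at h2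

/-- The constant of the complexity bound. -/
noncomputable def complexityConst (L τ₀ Δ : ℝ) : ℝ :=
  5376 * |Δ| * (sigmaFactor * maxTau L τ₀) ^ (1 / 2 : ℝ)
    + 7 * (Real.logb 2 (maxTau L τ₀ / τ₀) + 1)

theorem count_le_complexityConst (hn : 1 ≤ n) {L τ₀ Δ ε c : ℝ} (hτ₀ : 0 < τ₀) (hε : 0 < ε) {k : ℕ}
    (hk : k * (n * minDecrease n L τ₀ ε) ≤ Δ)
    (hc : c ≤ 7 * n * (2 * k + Real.logb 2 (maxTau L τ₀ / τ₀) + 1)) :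
    c ≤ complexityConst L τ₀ Δ * ((n : ℝ) ^ (1 / 2 : ℝ) * ε ^ (-(3 / 2) : ℝ) + n) := by
  have hn' : (0 : ℝ) < n := by exact_mod_cast hn
  have hM : 0 < maxTau L τ₀ := by linarith [two_mul_initial_le_maxTau L τ₀]
  have hs := sigmaFactor_pos
  have hp := minDecrease_pos hn (L := L) hτ₀ hε
  set lg := Real.logb 2 (maxTau L τ₀ / τ₀) with hlg
  have hlg0 : 0 ≤ lg := by
    refine Real.logb_nonneg (by norm_num) ?_
    rw [one_le_div hτ₀]
    linarith [two_mul_initial_le_maxTau L τ₀]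
  set A := (sigmaFactor * maxTau L τ₀) ^ (1 / 2 : ℝ) with hA
  have hA0 : 0 < A := by positivity
  have hεp : 0 < ε ^ (3 / 2 : ℝ) := by positivity
  have hinv : (minDecrease n L τ₀ ε)⁻¹
      = 384 * A * ((n : ℝ) ^ (1 / 2 : ℝ) * ε ^ (-(3 / 2) : ℝ)) := by
    unfold minDecrease
    rw [Real.mul_rpow (by positivity) hn'.le, Real.rpow_neg hε.le, ← hA]
    field_simp
  set W := (n : ℝ) ^ (1 / 2 : ℝ) * ε ^ (-(3 / 2) : ℝ) with hW
  have hW0 : 0 < W := by positivity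
  have h1 : n * k ≤ |Δ| * (384 * A * W) := by
    rw [← hinv, ← div_eq_mul_inv, le_div_iff₀ hp]
    linarith [le_abs_self Δ]
  have h2 : 0 ≤ 5376 * |Δ| * A * n := by positivity
  have h3 : 0 ≤ 7 * (lg + 1) * W := by positivity
  unfold complexityConst
  rw [← hA, ← hlg]
  linarith

/-! ### Termination -/

/-- `1` in the states of the main loop, `0` elsewhere. -/
def outerFlag : State n → ℕ
  | .outer .. => 1
  | _ => 0

/-- Only the return with status `success` is free of oracle calls, and it leads to a state where
the next step is not; so the number of steps is controlled by the number of oracle calls. -/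
theorem exec_of_run {f : E n → ℝ} {ψ : E n → EReal} {τ₀ ε : ℝ} {m : ℕ} {x₀ : E n}
    {s : ℕ → State n} (h0 : s 0 = State.init x₀ τ₀)
    (hs : ∀ i, ∃ q, Step f ψ τ₀ ε m (s i) q (s (i + 1))) (i : ℕ) :
    ∃ q, Exec f ψ τ₀ ε m x₀ q (s i) ∧ i ≤ 2 * q.length + outerFlag (s i) := by
  induction i with
  | zero => exact ⟨[], h0 ▸ Exec.start, Nat.zero_le _⟩
  | succ i ih =>
    obtain ⟨q, hq, hi⟩ := ih
    obtain ⟨q', hq'⟩ := hs i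
    refine ⟨q ++ q', hq.step hq', ?_⟩
    generalize s i = a at hi hq'
    generalize s (i + 1) = b at hq'
    rw [List.length_append]
    cases hq' <;> simp only [outerFlag, hessQueries, List.length_cons, List.length_nil] at hi ⊢ <;>
      omega

end FirstOrderCNM

/-- For `m = n`, every execution of the first-order cubic Newton method stops, at an iterate `x_k`
with `‖∇f(x_k) + ψ'(x_k)‖ ≤ ε` for some `ψ'(x_k) ∈ ∂ψ(x_k)`, after at most
`C (n^{1/2} ε^{-3/2} + n)` evaluations of `f` and `∇f`, where `C` depends only on `L`, `τ₀` and a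
bound `Δ` for `F(x₀) - F⋆`. -/
theorem mainTheorem3 (L τ₀ Δ : ℝ) (hL : 0 ≤ L) (hτ₀ : 0 < τ₀) :
    ∃ C : ℝ, ∀ (n : ℕ) (_ : 1 ≤ n)
      (f : FirstOrderCNM.E n → ℝ) (ψ : FirstOrderCNM.E n → EReal)
      (x₀ : FirstOrderCNM.E n) (ε : ℝ),
      ContDiff ℝ 2 f →
      FirstOrderCNM.HasLipschitzHessian f L →
      FirstOrderCNM.IsProperClosedConvex ψ →
      ⊥ < FirstOrderCNM.Fstar f ψ →
      x₀ ∈ FirstOrderCNM.dom ψ →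
      FirstOrderCNM.F f ψ x₀ - FirstOrderCNM.Fstar f ψ ≤ (Δ : EReal) →
      0 < ε →
      -- every execution makes few oracle calls, and can only end at an approximate solution
      (∀ (q : List (FirstOrderCNM.Query n)) (s : FirstOrderCNM.State n),
        FirstOrderCNM.Exec f ψ τ₀ ε n x₀ q s →
          (q.length : ℝ) ≤ C * ((n : ℝ) ^ (1 / 2 : ℝ) * ε ^ (-(3 / 2) : ℝ) + n) ∧
          ((∃ q' s', FirstOrderCNM.Step f ψ τ₀ ε n s q' s') ∨
            ∃ (k : ℕ) (x : FirstOrderCNM.E n), s = FirstOrderCNM.State.stopped k x ∧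
              FirstOrderCNM.IsApproxStationary f ψ ε x)) ∧
      -- no execution runs forever
      ¬ ∃ s : ℕ → FirstOrderCNM.State n, s 0 = FirstOrderCNM.State.init x₀ τ₀ ∧
          ∀ i, ∃ q, FirstOrderCNM.Step f ψ τ₀ ε n (s i) q (s (i + 1)) := by
  refine ⟨FirstOrderCNM.complexityConst L τ₀ Δ, ?_⟩
  intro n hn f ψ x₀ ε hf hLip hψ _ hx₀ hΔ hε
  have hbound : ∀ (q : List (FirstOrderCNM.Query n)) (s : FirstOrderCNM.State n),
      FirstOrderCNM.Exec f ψ τ₀ ε n x₀ q s → (q.length : ℝ) ≤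
        FirstOrderCNM.complexityConst L τ₀ Δ
          * ((n : ℝ) ^ (1 / 2 : ℝ) * ε ^ (-(3 / 2) : ℝ) + n) := by
    intro q s h
    obtain ⟨k, x, hx, hk, hc⟩ :=
      (h.invariant hn hL hτ₀ hε hf hLip hψ hx₀).exists_count hn hτ₀
    exact FirstOrderCNM.count_le_complexityConst hn hτ₀ hε
      (hk.trans (FirstOrderCNM.realF_sub_le hψ hx₀ hx hΔ)) hc
  refine ⟨fun q s h => ⟨hbound q s h,
    (h.invariant hn hL hτ₀ hε hf hLip hψ hx₀).exists_step_or_stopped hn hψ⟩, ?_⟩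
  rintro ⟨s, h0, hs⟩
  obtain ⟨K, hK⟩ := exists_nat_ge (FirstOrderCNM.complexityConst L τ₀ Δ
    * ((n : ℝ) ^ (1 / 2 : ℝ) * ε ^ (-(3 / 2) : ℝ) + n))
  obtain ⟨q, hq, hi⟩ := FirstOrderCNM.exec_of_run h0 hs (2 * K + 2)
  have hqK : q.length ≤ K := by exact_mod_cast (hbound q _ hq).trans hK
  have hflag : FirstOrderCNM.outerFlag (s (2 * K + 2)) ≤ 1 := by
    cases s (2 * K + 2) <;> simp [FirstOrderCNM.outerFlag]
  omega
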